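/- Let $m<n$ be natural numbers, let $A$ and $B$ be compact topological spaces, and let $f:A\to\mathbb{R}^n$ and $g:B\to\mathbb{R}^n$ be topological embeddings with $f(A)\cap g(B)=\emptyset$. Let $$\xi_{fg}:A\times B\to S^{n-1},\qquad \xi_{fg}(x,y)=\frac{f(x)-g(y)}{\|f(x)-g(y)\|}.$$ Write $\tilde H_{k}$ for reduced singular homology with integer coefficients, i.e. $\tilde H_k(X)=\ker\bigl(H_k(X;\mathbb{Z})\to H_k(\mathrm{pt};\mathbb{Z})\bigr)$. Fix an orientation of the sphere, i.e. an isomorphism $o:\tilde H_{n-1}(S^{n-1})\cong\mathbb{Z}$, and a class $\alpha\in\tilde H_{n-1}(A\times B)$. The degree of $\xi_{fg}$ with respect to $\alpha$ is the integer $o\bigl((\xi_{fg})_*\alpha\bigr)$; when $n\ge 2$, $A\times B$ is a closed oriented $(n-1)$-manifold and $\alpha$ is its fundamental class, this is the usual mapping degree of $\xi_{fg}$. Suppose that this degree is nonzero. Then for every linear map $L:\mathbb{R}^n\to\mathbb{R}^m$, $$L(f(A))\cap L(g(B))\neq\emptyset .$$ -/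

import Mathlib

open CategoryTheory

noncomputable section

/-- The singular homology group `H_k(X; ℤ)`. -/
abbrev singularHomologyZ (k : ℕ) (X : Type) [TopologicalSpace X] : ModuleCat.{0} ℤ :=
  ((AlgebraicTopology.singularHomologyFunctor (ModuleCat.{0} ℤ) k).obj
    (ModuleCat.of ℤ ℤ)).obj (TopCat.of X)

/-- The homomorphism `φ_* : H_k(X; ℤ) → H_k(Y; ℤ)` induced by a continuous map `φ : X → Y`. -/
def singularHomologyZMap (k : ℕ) {X Y : Type} [TopologicalSpace X] [TopologicalSpace Y]
    (φ : C(X, Y)) : singularHomologyZ k X →ₗ[ℤ] singularHomologyZ k Y :=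
  (((AlgebraicTopology.singularHomologyFunctor (ModuleCat.{0} ℤ) k).obj
    (ModuleCat.of ℤ ℤ)).map (TopCat.ofHom φ)).hom

/-- The constant map from `X` to a one-point space. -/
def toPoint (X : Type) [TopologicalSpace X] : C(X, Unit) := ContinuousMap.const X ()

/-- Reduced singular homology: the kernel of `H_k(X; ℤ) → H_k(point; ℤ)`. For `k > 0` it is all of
`H_k(X; ℤ)`; for `k = 0` it consists of the classes of augmentation zero. -/
def reducedHomologyZ (k : ℕ) (X : Type) [TopologicalSpace X] :
    Submodule ℤ (singularHomologyZ k X) :=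
  LinearMap.ker (singularHomologyZMap k (toPoint X))

theorem singularHomologyZMap_mem_reduced (k : ℕ) {X Y : Type} [TopologicalSpace X]
    [TopologicalSpace Y] (φ : C(X, Y)) (α : singularHomologyZ k X)
    (hα : α ∈ reducedHomologyZ k X) :
    singularHomologyZMap k φ α ∈ reducedHomologyZ k Y := by
  have h : (singularHomologyZMap k (toPoint Y)) (singularHomologyZMap k φ α)
      = singularHomologyZMap k (toPoint X) α := by
    have e : TopCat.ofHom (toPoint X) = TopCat.ofHom φ ≫ TopCat.ofHom (toPoint Y) := rfl
    simp only [singularHomologyZMap]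
    rw [e, Functor.map_comp]
    rfl
  exact h.trans hα

/-- The homomorphism induced by `φ` on reduced homology. -/
def reducedHomologyZMap (k : ℕ) {X Y : Type} [TopologicalSpace X] [TopologicalSpace Y]
    (φ : C(X, Y)) : reducedHomologyZ k X →ₗ[ℤ] reducedHomologyZ k Y :=
  (singularHomologyZMap k φ).restrict (singularHomologyZMap_mem_reduced k φ)

/-- The unit sphere `S^{n-1}` in Euclidean space `ℝⁿ`. -/
abbrev UnitSphere (n : ℕ) : Type := Metric.sphere (0 : EuclideanSpace ℝ (Fin n)) 1

/-- An orientation of `S^{n-1}`: an isomorphism of its top reduced homology group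
with `ℤ` (there are exactly two, for `n ≥ 1`). -/
abbrev SphereOrientation (n : ℕ) : Type :=
  reducedHomologyZ (n - 1) (UnitSphere n) ≃ₗ[ℤ] ℤ

/-- The degree of a map `φ : X → S^{n-1}` with respect to a class `α` of degree `n - 1` of `X` and
an orientation of the sphere: the integer `d` with `φ_* α = d • [S^{n-1}]`. If `X` is a closed
oriented manifold of dimension `n - 1 ≥ 1` and `α` is its fundamental class,
this is the usual mapping degree of `φ`. -/
def mapDegree {n : ℕ} {X : Type} [TopologicalSpace X] (o : SphereOrientation n)
    (α : reducedHomologyZ (n - 1) X) (φ : C(X, UnitSphere n)) : ℤ :=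
  o (reducedHomologyZMap (n - 1) φ α)

/-- The Gauss map `ξ(x, y) = (f x - g y) / ‖f x - g y‖` of two continuous maps into `ℝⁿ` with
disjoint images. -/
def gaussMap {n : ℕ} {A B : Type} [TopologicalSpace A] [TopologicalSpace B]
    (f : C(A, EuclideanSpace ℝ (Fin n))) (g : C(B, EuclideanSpace ℝ (Fin n)))
    (hfg : Disjoint (Set.range f) (Set.range g)) : C(A × B, UnitSphere n) where
  toFun p := ⟨‖f p.1 - g p.2‖⁻¹ • (f p.1 - g p.2), by
    have h : f p.1 - g p.2 ≠ 0 := fun h => Set.disjoint_left.mp hfg ⟨p.1, rfl⟩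
      ⟨p.2, (sub_eq_zero.mp h).symm⟩
    simp [norm_smul, h]⟩
  continuous_toFun := by
    have h : ∀ p : A × B, ‖f p.1 - g p.2‖ ≠ 0 := fun p h =>
      Set.disjoint_left.mp hfg ⟨p.1, rfl⟩ ⟨p.2, (sub_eq_zero.mp (norm_eq_zero.mp h)).symm⟩
    refine Continuous.subtype_mk (Continuous.smul (Continuous.inv₀ ?_ h) ?_) _ <;> fun_prop

end

/-! Since m < n, `L` kills some unit vector v. Were the Gauss map to take the value v at (x, y), f x
- g y would be a multiple of v, so L (f x) = L (g y). Hence if the two images are disjoint, the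
Gauss map misses v, so it is nullhomotopic (`nullhomotopic_of_forall_ne`), induces zero on reduced
homology, and has degree 0. -/

/-- Homotopic maps induce the same homomorphism on singular homology. -/
theorem singularHomologyZMap_eq_of_homotopy (k : ℕ) {X Y : Type} [TopologicalSpace X]
    [TopologicalSpace Y] {φ ψ : C(X, Y)} (H : ContinuousMap.Homotopy φ ψ) :
    singularHomologyZMap k φ = singularHomologyZMap k ψ :=
  congrArg ModuleCat.Hom.hom
    (TopCat.Homotopy.congr_homologyMap_singularChainComplexFunctor
      (f := TopCat.ofHom φ) (g := TopCat.ofHom ψ) H (ModuleCat.of ℤ ℤ) k)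

/-- Constant maps vanish on reduced homology. -/
theorem singularHomologyZMap_const_eq_zero (k : ℕ) {X Y : Type} [TopologicalSpace X]
    [TopologicalSpace Y] (y : Y) {α : singularHomologyZ k X} (hα : α ∈ reducedHomologyZ k X) :
    singularHomologyZMap k (ContinuousMap.const X y) α = 0 := by
  -- Constant maps factor through a point, where a reduced class dies by definition, even for k = 0.
  have h : singularHomologyZMap k (ContinuousMap.const X y) α
      = singularHomologyZMap k (ContinuousMap.const Unit y)
        (singularHomologyZMap k (toPoint X) α) := by
    have e : TopCat.ofHom (ContinuousMap.const X y)
        = TopCat.ofHom (toPoint X) ≫ TopCat.ofHom (ContinuousMap.const Unit y) := rfl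
    simp only [singularHomologyZMap]
    rw [e, Functor.map_comp]
    rfl
  rw [h, show singularHomologyZMap k (toPoint X) α = 0 from hα, map_zero]

/-- Nullhomotopic maps vanish on reduced homology. -/
theorem reducedHomologyZMap_eq_zero_of_nullhomotopic (k : ℕ) {X Y : Type} [TopologicalSpace X]
    [TopologicalSpace Y] {φ : C(X, Y)} (hφ : φ.Nullhomotopic) : reducedHomologyZMap k φ = 0 := by
  obtain ⟨y, ⟨H⟩⟩ := hφ
  ext α
  change singularHomologyZMap k φ α = 0
  rw [singularHomologyZMap_eq_of_homotopy k H, singularHomologyZMap_const_eq_zero k y α.2]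

/-- If the segment from x to -v meets 0 at time t, comparing norms gives 1 - t = t, so t ≠ 0 and x =
v. -/
theorem one_sub_smul_sub_smul_ne_zero {E : Type*} [NormedAddCommGroup E] [NormedSpace ℝ E]
    {x v : E} (hx : ‖x‖ = 1) (hv : ‖v‖ = 1) (hxv : x ≠ v) (t : unitInterval) :
    (1 - (t : ℝ)) • x - (t : ℝ) • v ≠ 0 := by
  intro h
  have h1 : (1 - (t : ℝ)) • x = (t : ℝ) • v := sub_eq_zero.mp h
  have h2 : 1 - (t : ℝ) = t := by
    simpa [norm_smul, hx, hv, abs_of_nonneg t.2.1, abs_of_nonneg (sub_nonneg.mpr t.2.2)]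
      using congrArg norm h1
  rw [h2] at h1
  exact hxv (smul_right_injective E (show (t : ℝ) ≠ 0 by intro h0; simp [h0] at h2) h1)

/-- A map to the sphere that misses a point is nullhomotopic. -/
theorem nullhomotopic_of_forall_ne {n : ℕ} {X : Type} [TopologicalSpace X]
    (φ : C(X, UnitSphere n)) (v : UnitSphere n) (hv : ∀ x, φ x ≠ v) : φ.Nullhomotopic := by
  have hne : ∀ p : unitInterval × X,
      ‖(1 - (p.1 : ℝ)) • (φ p.2 : EuclideanSpace ℝ (Fin n)) - (p.1 : ℝ) • (v : _)‖ ≠ 0 := fun p =>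
    norm_ne_zero_iff.mpr (one_sub_smul_sub_smul_ne_zero (norm_eq_of_mem_sphere _)
      (norm_eq_of_mem_sphere _) (fun h => hv p.2 (Subtype.ext h)) p.1)
  -- Contract to the antipode of the missed point: follow the segment from φ x to -v, projected
  -- radially to the sphere.
  refine ⟨-v, ⟨⟨⟨fun p => ⟨‖(1 - (p.1 : ℝ)) • (φ p.2 : EuclideanSpace ℝ (Fin n))
      - (p.1 : ℝ) • (v : _)‖⁻¹ • ((1 - (p.1 : ℝ)) • (φ p.2 : EuclideanSpace ℝ (Fin n))
      - (p.1 : ℝ) • (v : _)), ?_⟩, ?_⟩, ?_, ?_⟩⟩⟩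
  · simp [norm_smul, inv_mul_cancel₀ (hne p)]
  · refine Continuous.subtype_mk (Continuous.smul (Continuous.inv₀ ?_ hne) ?_) _ <;> fun_prop
  · intro x
    ext1
    simp
  · intro x
    ext1
    simp

theorem theorem4p2 (m n : ℕ) (hmn : m < n)
    (A B : Type) [TopologicalSpace A] [CompactSpace A] [TopologicalSpace B] [CompactSpace B]
    (f : C(A, EuclideanSpace ℝ (Fin n))) (g : C(B, EuclideanSpace ℝ (Fin n)))
    (hf : Topology.IsEmbedding f) (hg : Topology.IsEmbedding g)
    (hfg : Disjoint (Set.range f) (Set.range g))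
    (o : SphereOrientation n) (α : reducedHomologyZ (n - 1) (A × B))
    (hdeg : mapDegree o α (gaussMap f g hfg) ≠ 0)
    (L : EuclideanSpace ℝ (Fin n) →ₗ[ℝ] EuclideanSpace ℝ (Fin m)) :
    ((L '' Set.range f) ∩ (L '' Set.range g)).Nonempty := by
  obtain ⟨u, hu, hu0⟩ := (LinearMap.ker L).ne_bot_iff.mp
    (LinearMap.ker_ne_bot_of_finrank_lt (f := L) (by simpa using hmn))
  by_contra hempty
  refine hdeg ?_
  have hnull : (gaussMap f g hfg).Nullhomotopic := by
    -- The missed point is the direction of the kernel vector `u`.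
    refine nullhomotopic_of_forall_ne _ ⟨‖u‖⁻¹ • u, by simp [norm_smul, hu0]⟩ fun p hp => hempty ?_
    have hp' : ‖f p.1 - g p.2‖⁻¹ • (f p.1 - g p.2) = ‖u‖⁻¹ • u := congrArg Subtype.val hp
    have hne : ‖f p.1 - g p.2‖ ≠ 0 := fun h => Set.disjoint_left.mp hfg ⟨p.1, rfl⟩
      ⟨p.2, (sub_eq_zero.mp (norm_eq_zero.mp h)).symm⟩
    have hL : L (f p.1) = L (g p.2) := by
      have h := congrArg L hp'
      rw [map_smul, map_smul, LinearMap.mem_ker.mp hu, smul_zero] at h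
      exact sub_eq_zero.mp (by
        rw [← map_sub]
        exact (smul_eq_zero.mp h).resolve_left (inv_ne_zero hne))
    exact ⟨L (f p.1), ⟨_, ⟨p.1, rfl⟩, rfl⟩, ⟨_, ⟨p.2, rfl⟩, hL.symm⟩⟩
  rw [mapDegree, reducedHomologyZMap_eq_zero_of_nullhomotopic _ hnull, LinearMap.zero_apply,
    map_zero]
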